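/- Consider the operational TSO model with processes $1,\dots,n$, $n\ge 2$, and finitely many shared variables. Each process $i$ has a FIFO store buffer, emptied by a local dispatcher $d_i$, whose action $\mathtt{prop}$ writes the oldest buffered item to memory. Processes perform reads (answered from the own buffer if it holds the variable, otherwise from memory), writes (appended to the buffer), fences $\mathtt F$ (enabled only when the own buffer is empty), read-modify-writes $\mathtt{RMW}(x,v_{exp},v_{new})$ (enabled only when the own buffer is empty and $x=v_{exp}$ in memory), internal actions, and responses to operations; the environment invokes operations. The local state of a process is the history of its invocations, actions and values read. In a run, an enabled, conflict-free joint action of all agents takes place in each round, the processes act according to a (possibly nondeterministic) protocol, which maps local states to nonempty sets of actions, and no operation is invoked at a process whose previous operation is pending. A run is fair if every buffered item is eventually propagated and no process stops moving forever while it continuously has an enabled action to perform. A snapshot object over a set $W$ stores a vector in $(W\cup\{\bot\})^n$, initially $(\bot,\dots,\bot)$ with $\bot\notin W$; $\mathrm{update}_j(w)$, $w\in W$, sets component $j$ to $w$ and $\mathrm{scan}_i$ returns the vector. By convention, in every run each process is asked to write each value at most once. An implementation (a protocol with initial memory contents) is linearizable if the history of every finite prefix of a run is linearizable with respect to this object.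 It is obstruction-free if a process with a pending operation completes it whenever, from some time on, no other process takes steps, the process itself is scheduled fairly and buffered items are eventually propagated. An operation $X$ invoked at a process in round $t+1$ and returning in round $t'$ has start $t_{X.s}=t$ and end $t_{X.e}=t'$; write $X<_rY$ if $t_{X.e}<t_{Y.s}$ in $r$. It runs solo, when performed by $i$, if only $i$ and $d_i$ take actions between its start and its end. Theorem. Let $\mathcal I$ be an obstruction-free linearizable snapshot implementation in TSO for $n\ge 2$ processes. Let $r$ be a run of $\mathcal I$ in which an operation $\mathrm{scan}_i$ is performed by process $i$ running solo and completes, and suppose that $\mathrm{scan}_i$ contains neither $\mathtt F$ nor $\mathtt{RMW}$ actions in $r$. Then for every process $j$ and every $v\in W$ such that $\mathrm{update}_j(v)$ has not been invoked in $r$ by the end of $\mathrm{scan}_i$, there is a fair run $\tilde r$ of $\mathcal I$ such that $\tilde r$ is indistinguishable to $i$ from $r$ until the end of $\mathrm{scan}_i$ (process $i$ has the same local states in $\tilde r$ and $r$ at all times up to $t_{\mathrm{scan}_i.e}$), $\mathrm{scan}_i<_{\tilde r}\mathrm{update}_j(v)$, and $\mathrm{update}_j(v)$ completes in $\tilde r$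 and contains an $\mathtt F$ or $\mathtt{RMW}$ action. -/

import Mathlib

namespace TSO

open Classical in
/-- The pending value of `x` in a store buffer: the latest (rightmost) entry for `x`, if any. -/
noncomputable def bufLookup {Var Val : Type*} (β : List (Var × Val)) (x : Var) : Option Val :=
  ((β.filter (fun p => p.1 = x)).getLast?).map Prod.snd

/-- A basic TSO state: main memory, and a store buffer (oldest entry first) for each process. -/
structure MemState (n : ℕ) (Var Val : Type*) where
  mem : Var → Val
  buf : Fin n → List (Var × Val)

/-- The actions of a process. `internal a` and `ret y` (the response, with value `y`, to the pending
operation) do not touch the TSO state; `null` is the null action. -/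
inductive Act (Var Val Intl Resp : Type*) where
  | null
  | read (x : Var)
  | write (x : Var) (v : Val)
  | fence
  | rmw (x : Var) (vexp vnew : Val)
  | internal (a : Intl)
  | ret (y : Resp)

/-- The records that make up local states. A read record does not show whether the value came from
the buffer or from memory. -/
inductive Rec (Var Val Intl Op Resp : Type*) where
  | read (x : Var) (v : Val)
  | write (x : Var) (v : Val)
  | fence
  | rmw (x : Var) (vexp vnew : Val)
  | internal (a : Intl)
  | ret (y : Resp)
  | invoke (o : Op)

/-- The local state of a process is the history of its records, oldest first. -/
abbrev LocalState (Var Val Intl Op Resp : Type*) := List (Rec Var Val Intl Op Resp)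

/-- An operation is pending if the last invocation has not been followed by a response. -/
def LocalState.Pending {Var Val Intl Op Resp : Type*} (l : LocalState Var Val Intl Op Resp) : Prop :=
  ∃ (l₁ : List (Rec Var Val Intl Op Resp)) (o : Op) (l₂ : List (Rec Var Val Intl Op Resp)),
    l = l₁ ++ Rec.invoke o :: l₂ ∧ ∀ y : Resp, Rec.ret y ∉ l₂

/-- A global state. -/
structure GlobalState (n : ℕ) (Var Val Intl Op Resp : Type*) where
  tso : MemState n Var Val
  loc : Fin n → LocalState Var Val Intl Op Resp

/-- A joint action: an action for each process, whether each local dispatcher propagates, and at most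
one invocation by the environment for each process. -/
structure JointAction (n : ℕ) (Var Val Intl Op Resp : Type*) where
  act : Fin n → Act Var Val Intl Resp
  prop : Fin n → Bool
  inv : Fin n → Option Op

/-- The agents: processes and their local dispatchers. -/
inductive Agent (n : ℕ) where
  | proc (i : Fin n)
  | disp (i : Fin n)

section Semantics

variable {n : ℕ} {Var Val Intl Op Resp : Type*}

/-- The value returned by a read of `x` by process `i`: from the buffer if possible, otherwise from
memory. -/
noncomputable def MemState.readVal (σ : MemState n Var Val) (i : Fin n) (x : Var) : Val :=
  (bufLookup (σ.buf i) x).getD (σ.mem x)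

/-- Preconditions of process actions. -/
def MemState.Enabled (σ : MemState n Var Val) (i : Fin n) : Act Var Val Intl Resp → Prop
  | .fence => σ.buf i = []
  | .rmw x vexp _ => σ.buf i = [] ∧ σ.mem x = vexp
  | _ => True

open Classical in
/-- Effect of an action of process `i` on the TSO state. -/
noncomputable def MemState.doAct (σ : MemState n Var Val) (i : Fin n) :
    Act Var Val Intl Resp → MemState n Var Val
  | .write x v => { σ with buf := Function.update σ.buf i (σ.buf i ++ [(x, v)]) }
  | .rmw x _ vnew => { σ with mem := Function.update σ.mem x vnew }
  | _ => σ

open Classical in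
/-- Effect of a propagation by the local dispatcher of `i`. -/
noncomputable def MemState.doProp (σ : MemState n Var Val) (i : Fin n) : MemState n Var Val :=
  match σ.buf i with
  | [] => σ
  | (x, v) :: β => { mem := Function.update σ.mem x v, buf := Function.update σ.buf i β }

/-- The records added to the local state of `i` by its action in the TSO state `σ`. -/
noncomputable def MemState.record (σ : MemState n Var Val) (i : Fin n) :
    Act Var Val Intl Resp → List (Rec Var Val Intl Op Resp)
  | .null => []
  | .read x => [.read x (σ.readVal i x)]
  | .write x v => [.write x v]
  | .fence => [.fence]
  | .rmw x vexp vnew => [.rmw x vexp vnew]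
  | .internal a => [.internal a]
  | .ret y => [.ret y]

/-- Process `i` performs a read of `x` from memory. -/
def ReadsMem (σ : MemState n Var Val) (a : JointAction n Var Val Intl Op Resp) (i : Fin n) (x : Var) :
    Prop :=
  a.act i = .read x ∧ bufLookup (σ.buf i) x = none

/-- Agent `b` performs a memory access of `x`. -/
def Accesses (σ : MemState n Var Val) (a : JointAction n Var Val Intl Op Resp) :
    Agent n → Var → Prop
  | .proc i, x => (∃ vexp vnew, a.act i = .rmw x vexp vnew) ∨ ReadsMem σ a i x
  | .disp i, x => a.prop i = true ∧ ∃ v β, σ.buf i = (x, v) :: β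

/-- The actions of agents `b` and `c` conflict: both access the same variable, not both are reads
from memory, and they are not a propagation by the dispatcher of a process and a read from memory
by that same process. -/
def Conflict (σ : MemState n Var Val) (a : JointAction n Var Val Intl Op Resp) (b c : Agent n) :
    Prop :=
  ∃ x, Accesses σ a b x ∧ Accesses σ a c x ∧
    ¬ (∃ i j, b = .proc i ∧ c = .proc j ∧ ReadsMem σ a i x ∧ ReadsMem σ a j x) ∧
    ¬ (∃ i, ((b = .disp i ∧ c = .proc i) ∨ (b = .proc i ∧ c = .disp i)) ∧ ReadsMem σ a i x)

/-- The TSO state after a joint action: the actions of the processes, and then those of the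
dispatchers, are performed one by one. -/
noncomputable def MemState.doJoint (σ : MemState n Var Val)
    (a : JointAction n Var Val Intl Op Resp) : MemState n Var Val :=
  let σ₁ := (List.finRange n).foldl (fun s i => s.doAct i (a.act i)) σ
  (List.finRange n).foldl (fun s i => if a.prop i then s.doProp i else s) σ₁

/-- The global state after a joint action; invocations by the environment are recorded last. -/
noncomputable def GlobalState.next (g : GlobalState n Var Val Intl Op Resp)
    (a : JointAction n Var Val Intl Op Resp) : GlobalState n Var Val Intl Op Resp where
  tso := g.tso.doJoint a
  loc i := g.loc i ++ g.tso.record i (a.act i) ++ ((a.inv i).map Rec.invoke).toList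

/-- The joint action is enabled in `g`: every action in it is, there are no conflicts, and the
environment invokes an operation at `i` only if `i` has responded to all earlier invocations. -/
structure JointAction.Enabled (a : JointAction n Var Val Intl Op Resp)
    (g : GlobalState n Var Val Intl Op Resp) : Prop where
  act : ∀ i, g.tso.Enabled i (a.act i)
  prop : ∀ i, a.prop i = true → g.tso.buf i ≠ []
  noConflict : ∀ b c, b ≠ c → ¬ Conflict g.tso a b c
  inv : ∀ i o, a.inv i = some o →
    ¬ LocalState.Pending (g.loc i ++ g.tso.record i (a.act i))

end Semantics

/-- An implementation: a nondeterministic protocol for each process (a choice of possible actions in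
each local state) and the initial contents of memory. A process responds only to a pending
operation. -/
structure Implementation (n : ℕ) (Var Val Intl Op Resp : Type*) where
  protocol : Fin n → LocalState Var Val Intl Op Resp → Set (Act Var Val Intl Resp)
  protocol_nonempty : ∀ i l, (protocol i l).Nonempty
  ret_pending : ∀ i l y, Act.ret y ∈ protocol i l → l.Pending
  init : Var → Val

/-- An infinite sequence of global states, with `step t` the joint action performed at `state t`,
that is, in round `t + 1`. -/
structure Run (n : ℕ) (Var Val Intl Op Resp : Type*) where
  state : ℕ → GlobalState n Var Val Intl Op Resp
  step : ℕ → JointAction n Var Val Intl Op Resp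

section Runs

variable {n : ℕ} {Var Val Intl Op Resp : Type*}

/-- `r` is a TSO run of the protocol of `I`, started in its initial state. -/
structure Run.IsRunOf (r : Run n Var Val Intl Op Resp) (I : Implementation n Var Val Intl Op Resp) :
    Prop where
  init_mem : (r.state 0).tso.mem = I.init
  init_buf : ∀ i, (r.state 0).tso.buf i = []
  init_loc : ∀ i, (r.state 0).loc i = []
  enabled : ∀ t, (r.step t).Enabled (r.state t)
  next : ∀ t, r.state (t + 1) = (r.state t).next (r.step t)
  protocol : ∀ t i, (r.step t).act i ≠ .null →
    (r.step t).act i ∈ I.protocol i ((r.state t).loc i)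

/-- Every item in a store buffer is eventually propagated. -/
def Run.DispatchFair (r : Run n Var Val Intl Op Resp) : Prop :=
  ∀ i t, (r.state t).tso.buf i ≠ [] → ∃ t', t ≤ t' ∧ (r.step t').prop i = true

/-- Process `i` has an enabled (non-null) action to perform at time `t`, according to its protocol. -/
def Run.CanMove (r : Run n Var Val Intl Op Resp) (I : Implementation n Var Val Intl Op Resp)
    (i : Fin n) (t : ℕ) : Prop :=
  ∃ a ∈ I.protocol i ((r.state t).loc i), a ≠ .null ∧ (r.state t).tso.Enabled i a

/-- Process `i` does not stop moving while it continuously has an enabled action to perform. -/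
def Run.ProcFair (r : Run n Var Val Intl Op Resp) (I : Implementation n Var Val Intl Op Resp)
    (i : Fin n) : Prop :=
  ∀ t, ∃ t', t ≤ t' ∧ ((r.step t').act i ≠ .null ∨ ¬ r.CanMove I i t')

/-- Fairness to all agents. -/
def Run.Fair (r : Run n Var Val Intl Op Resp) (I : Implementation n Var Val Intl Op Resp) : Prop :=
  r.DispatchFair ∧ ∀ i, r.ProcFair I i

/-- Operation `o`, invoked at process `i` in round `t + 1`, completes with response `y` in
round `t'`. -/
def Run.OpBetween (r : Run n Var Val Intl Op Resp) (i : Fin n) (o : Op) (y : Resp) (t t' : ℕ) :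
    Prop :=
  (r.step t).inv i = some o ∧
    ∃ u, t < u ∧ t' = u + 1 ∧ (r.step u).act i = .ret y ∧
      ∀ s, t < s → s < u → ∀ z, (r.step s).act i ≠ .ret z

/-- Only `i` and its local dispatcher take actions between times `t` and `t'`. -/
def Run.Solo (r : Run n Var Val Intl Op Resp) (i : Fin n) (t t' : ℕ) : Prop :=
  ∀ s, t ≤ s → s < t' → ∀ k, k ≠ i → (r.step s).act k = .null ∧ (r.step s).prop k = false

/-- The operation of process `i` that is invoked in round `t + 1` and ends in round `t'` contains a
fence or a read-modify-write action. -/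
def Run.ContainsSync (r : Run n Var Val Intl Op Resp) (i : Fin n) (t t' : ℕ) : Prop :=
  ∃ s, t < s ∧ s < t' ∧
    ((r.step s).act i = .fence ∨ ∃ x vexp vnew, (r.step s).act i = .rmw x vexp vnew)

end Runs

/-- The operations of a snapshot object over the set `W` of values. -/
inductive SnapOp (W : Type*) where
  | update (w : W)
  | scan

/-- The responses of a snapshot object; `none` is the initial value `⊥` of each component. -/
inductive SnapResp (n : ℕ) (W : Type*) where
  | ack
  | view (V : Fin n → Option W)

/-- An operation in a linearization: its process, its start time in the run, and its response. -/
structure LinOp (n : ℕ) (W : Type*) where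
  proc : Fin n
  start : ℕ
  op : SnapOp W
  resp : SnapResp n W

/-- The sequential specification of the snapshot object, started with contents `V`. -/
def SnapLegal {n : ℕ} {W : Type*} : (Fin n → Option W) → List (LinOp n W) → Prop
  | _, [] => True
  | V, e :: L =>
    match e.op with
    | .update w => e.resp = .ack ∧ SnapLegal (Function.update V e.proc (some w)) L
    | .scan => e.resp = .view V ∧ SnapLegal V L

section Snapshot

variable {n : ℕ} {W Var Val Intl : Type*}

/-- Each process is asked to write each value at most once. -/
def Run.WriteOnce (r : Run n Var Val Intl (SnapOp W) (SnapResp n W)) : Prop :=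
  ∀ i w t t', (r.step t).inv i = some (.update w) → (r.step t').inv i = some (.update w) → t = t'

/-- `L` is a linearization of the history of the first `T` rounds of `r`: it consists of operations
invoked there, includes all those completed there (with their actual responses) and possibly some
pending ones, is legal, and respects the order of operations of each process as well as the real-time
order (an operation that ends at a time smaller than the start of another one comes first). -/
structure IsLinearization (r : Run n Var Val Intl (SnapOp W) (SnapResp n W)) (T : ℕ)
    (L : List (LinOp n W)) : Prop where
  invoked : ∀ e ∈ L, e.start < T ∧ (r.step e.start).inv e.proc = some e.op
  response : ∀ e ∈ L, ∀ y t', r.OpBetween e.proc e.op y e.start t' → t' ≤ T → e.resp = y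
  completed : ∀ i o y t t', r.OpBetween i o y t t' → t' ≤ T →
    ∃ e ∈ L, e.proc = i ∧ e.start = t
  procOrder : L.Pairwise (fun e f => e.proc = f.proc → e.start < f.start)
  realTime : L.Pairwise (fun e f =>
    ¬ ∃ y t', r.OpBetween f.proc f.op y f.start t' ∧ t' ≤ T ∧ t' < e.start)
  legal : SnapLegal (fun _ => none) L

/-- `I` is a linearizable snapshot implementation: every finite history of it has a linearization. -/
def Linearizable (I : Implementation n Var Val Intl (SnapOp W) (SnapResp n W)) : Prop :=
  ∀ r : Run n Var Val Intl (SnapOp W) (SnapResp n W), r.IsRunOf I → r.WriteOnce → r.Fair I →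
    ∀ T, ∃ L, IsLinearization r T L

/-- `I` is obstruction-free: a process with a pending operation completes it if, from some time on,
the other processes take no steps, while the process itself is scheduled fairly and buffered items
are eventually propagated. -/
def ObstructionFree (I : Implementation n Var Val Intl (SnapOp W) (SnapResp n W)) : Prop :=
  ∀ r : Run n Var Val Intl (SnapOp W) (SnapResp n W), r.IsRunOf I → r.WriteOnce → r.DispatchFair →
    ∀ i, r.ProcFair I i → ∀ t, ((r.state t).loc i).Pending →
      (∀ s, t ≤ s → ∀ k, k ≠ i → (r.step s).act k = .null) →
      ∃ s y, t ≤ s ∧ (r.step s).act i = .ret y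

end Snapshot

end TSO

/-! Without a fence or a read-modify-write, everything an operation of `j` does may stay in the
store buffer of `j`, invisible to the other processes; but an update must be visible to any scan
that starts after it has ended. From the state at the end of the given scan, obstruction-freedom
lets `j` and some other process `k` finish their pending operations one after the other, and all
buffers are flushed. Then `j` is asked to perform `update v` and runs solo until it responds. The
claim is that this solo execution contains a fence or a read-modify-write; the required run is then
obtained by scheduling all agents fairly afterwards. Suppose the claim fails. Then the same steps of
`j` can be repeated with no propagation at all (`Exec.exists_without_prop`): propagating its own
items never changes what `j` reads, and its actions are never blocked by a nonempty buffer. Memory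
is left untouched, so a solo scan by `k` after the update can proceed exactly as it would with no
update at all (`Exec.exists_of_agree`) and returns the same vector. Linearizability of the run
without the update forbids `v` in component `j` (`IsLinearization.scan_ne`); linearizability of the
run with the update requires it (`IsLinearization.scan_eq`). Executions are handled as finite lists
of single moves. Obstruction-freedom and linearizability speak of infinite runs, so each finite
execution is extended to one by a round-robin-like schedule (`Run.IsRunOf.exists_continues`). -/

namespace TSO

/-! ### Single moves as joint actions -/

section Moves

variable {n : ℕ} {Var Val Intl Op Resp : Type*}

/-- An atomic step of the system: at most one agent acts, or one operation is invoked. -/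
inductive Move (n : ℕ) (Var Val Intl Op Resp : Type*) where
  | idle
  | act (k : Fin n) (a : Act Var Val Intl Resp)
  | prop (k : Fin n)
  | inv (k : Fin n) (o : Op)

namespace Move

/-- The joint action that consists of a single move. -/
def toJoint : Move n Var Val Intl Op Resp → JointAction n Var Val Intl Op Resp
  | .idle => ⟨fun _ => .null, fun _ => false, fun _ => none⟩
  | .act k a => ⟨fun i => if i = k then a else .null, fun _ => false, fun _ => none⟩
  | .prop k => ⟨fun _ => .null, fun i => decide (i = k), fun _ => none⟩
  | .inv k o => ⟨fun _ => .null, fun _ => false, fun i => if i = k then some o else none⟩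

/-- The effect of a move on the global state. -/
noncomputable def apply (g : GlobalState n Var Val Intl Op Resp) :
    Move n Var Val Intl Op Resp → GlobalState n Var Val Intl Op Resp
  | .idle => g
  | .act k a => ⟨g.tso.doAct k a, Function.update g.loc k (g.loc k ++ g.tso.record k a)⟩
  | .prop k => ⟨g.tso.doProp k, g.loc⟩
  | .inv k o => ⟨g.tso, Function.update g.loc k (g.loc k ++ [.invoke o])⟩

/-- The move is enabled and follows the protocol. -/
def Valid (I : Implementation n Var Val Intl Op Resp) (g : GlobalState n Var Val Intl Op Resp) :
    Move n Var Val Intl Op Resp → Prop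
  | .idle => True
  | .act k a => a ∈ I.protocol k (g.loc k) ∧ g.tso.Enabled k a
  | .prop k => g.tso.buf k ≠ []
  | .inv k _ => ¬ (g.loc k).Pending

/-- The move is not an invocation, and if it is an action, it is one of a process in `S`. -/
def Quiet (S : Set (Fin n)) : Move n Var Val Intl Op Resp → Prop
  | .idle => True
  | .act k _ => k ∈ S
  | .prop _ => True
  | .inv _ _ => False

end Move

theorem foldl_ite_eq {α σ : Type*} [DecidableEq α] (F : σ → σ) (k : α) (l : List α)
    (hl : l.Nodup) (s : σ) :
    l.foldl (fun s i => if i = k then F s else s) s = if k ∈ l then F s else s := by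
  induction l generalizing s with
  | nil => simp
  | cons a l ih =>
    rw [List.nodup_cons] at hl
    rw [List.foldl_cons, ih hl.2]
    by_cases h : a = k
    · subst h; simp [hl.1]
    · simp [h, Ne.symm h]

theorem doAct_null (s : MemState n Var Val) (i : Fin n) :
    s.doAct i (Act.null : Act Var Val Intl Resp) = s := rfl

theorem foldl_null (s : MemState n Var Val) (l : List (Fin n)) :
    l.foldl (fun s i => s.doAct i (Act.null : Act Var Val Intl Resp)) s = s := by
  induction l with
  | nil => rfl
  | cons a l ih => simp [doAct_null]

theorem Move.next_toJoint (g : GlobalState n Var Val Intl Op Resp)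
    (x : Move n Var Val Intl Op Resp) : g.next x.toJoint = x.apply g := by
  have hprop : ∀ s : MemState n Var Val,
      (List.finRange n).foldl (fun s _ => s) s = s := by
    intro s; induction List.finRange n with
    | nil => rfl
    | cons a l ih => simp
  cases x with
  | idle =>
    simp [GlobalState.next, toJoint, apply, MemState.doJoint, foldl_null, MemState.record]
  | act k a =>
    have h1 : (fun (s : MemState n Var Val) (i : Fin n) =>
        s.doAct i (if i = k then a else Act.null)) =
        fun s i => if i = k then s.doAct k a else s := by
      funext s i; split_ifs with h
      · rw [h]
      · rfl
    have h2 := foldl_ite_eq (fun s : MemState n Var Val => s.doAct k a) k _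
      (List.nodup_finRange n) g.tso
    simp only [GlobalState.next, toJoint, apply, MemState.doJoint, h1, h2, List.mem_finRange,
      if_true, Bool.false_eq_true, if_false, hprop, GlobalState.mk.injEq, true_and]
    funext i
    by_cases h : i = k
    · subst h; simp
    · simp [h, MemState.record]
  | prop k =>
    have h1 : (fun (s : MemState n Var Val) (i : Fin n) =>
        if decide (i = k) = true then s.doProp i else s) =
        fun s i => if i = k then s.doProp k else s := by
      funext s i; by_cases h : i = k <;> simp [h]
    have h2 := foldl_ite_eq (fun s : MemState n Var Val => s.doProp k) k _
      (List.nodup_finRange n) g.tso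
    rw [← h1, if_pos (List.mem_finRange k)] at h2
    simp [GlobalState.next, toJoint, apply, MemState.doJoint, foldl_null, MemState.record, ← h2]
  | inv k o =>
    simp only [GlobalState.next, toJoint, apply, MemState.doJoint, foldl_null,
      Bool.false_eq_true, if_false, hprop, GlobalState.mk.injEq, true_and]
    funext i
    by_cases h : i = k
    · subst h; simp [MemState.record]
    · simp [h, MemState.record]

/-- At most one agent accesses memory in a single move, so two distinct agents never conflict. -/
theorem Move.Valid.enabled {I : Implementation n Var Val Intl Op Resp}
    {g : GlobalState n Var Val Intl Op Resp} {x : Move n Var Val Intl Op Resp}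
    (h : x.Valid I g) : x.toJoint.Enabled g := by
  cases x with
  | idle =>
    refine ⟨fun i => trivial, fun i hi => ?_, fun b c hbc => ?_, fun i o hi => ?_⟩
    · simp [toJoint] at hi
    · rintro ⟨x, hb, -⟩
      cases b <;> simp [Accesses, toJoint, ReadsMem] at hb
    · simp [toJoint] at hi
  | act k a =>
    refine ⟨fun i => ?_, fun i hi => ?_, fun b c hbc => ?_, fun i o hi => ?_⟩
    · by_cases hi : i = k
      · subst hi; simpa [toJoint] using h.2
      · simp [toJoint, hi, MemState.Enabled]
    · simp [toJoint] at hi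
    · have key : ∀ (b : Agent n) (x : Var), Accesses g.tso
          (toJoint (.act k a) : JointAction n Var Val Intl Op Resp) b x → b = .proc k := by
        rintro (i | i) x hb
        · by_cases hi : i = k
          · rw [hi]
          · simp [Accesses, toJoint, ReadsMem, hi] at hb
        · simp [Accesses, toJoint] at hb
      rintro ⟨x, hb, hc, -⟩
      exact hbc ((key b x hb).trans (key c x hc).symm)
    · simp [toJoint] at hi
  | prop k =>
    refine ⟨fun i => trivial, fun i hi => ?_, fun b c hbc => ?_, fun i o hi => ?_⟩
    · have : i = k := by simpa [toJoint] using hi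
      rw [this]; exact h
    · have key : ∀ (b : Agent n) (x : Var), Accesses g.tso
          (toJoint (.prop k) : JointAction n Var Val Intl Op Resp) b x → b = .disp k := by
        rintro (i | i) x hb
        · simp [Accesses, toJoint, ReadsMem] at hb
        · have : i = k := by simpa [toJoint] using hb.1
          rw [this]
      rintro ⟨x, hb, hc, -⟩
      exact hbc ((key b x hb).trans (key c x hc).symm)
    · simp [toJoint] at hi
  | inv k o =>
    refine ⟨fun i => trivial, fun i hi => ?_, fun b c hbc => ?_, fun i o' hi => ?_⟩
    · simp [toJoint] at hi
    · rintro ⟨x, hb, -⟩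
      cases b <;> simp [Accesses, toJoint, ReadsMem] at hb
    · by_cases hk : i = k
      · subst hk; simpa [toJoint, MemState.record] using (show ¬ (g.loc i).Pending from h)
      · simp [toJoint, hk] at hi

theorem Move.Valid.protocol {I : Implementation n Var Val Intl Op Resp}
    {g : GlobalState n Var Val Intl Op Resp} {x : Move n Var Val Intl Op Resp}
    (h : x.Valid I g) (i : Fin n) (hi : x.toJoint.act i ≠ .null) :
    x.toJoint.act i ∈ I.protocol i (g.loc i) := by
  cases x with
  | act k a =>
    by_cases hk : i = k
    · subst hk; simpa [toJoint] using h.1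
    · simp [toJoint, hk] at hi
  | _ => simp [toJoint] at hi

theorem Move.eq_inv {x : Move n Var Val Intl Op Resp} {p : Fin n} {o : Op}
    (h : x.toJoint.inv p = some o) : x = .inv p o := by
  cases x with
  | inv k o' =>
    by_cases hk : p = k
    · subst hk; simpa [toJoint] using h
    · simp [toJoint, hk] at h
  | _ => simp [toJoint] at h

theorem Move.eq_act {x : Move n Var Val Intl Op Resp} {p : Fin n} {a : Act Var Val Intl Resp}
    (h : x.toJoint.act p = a) (ha : a ≠ .null) : x = .act p a := by
  cases x with
  | act k a' =>
    by_cases hk : p = k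
    · subst hk; simpa [toJoint] using h
    · simp [toJoint, hk] at h; exact absurd h.symm ha
  | _ => exact absurd h.symm ha

/-! ### Finite executions and their concatenation to runs -/

/-- A finite execution from `g` to `g'` with the given moves. -/
inductive Exec (I : Implementation n Var Val Intl Op Resp) :
    GlobalState n Var Val Intl Op Resp → List (Move n Var Val Intl Op Resp) →
    GlobalState n Var Val Intl Op Resp → Prop
  | nil (g) : Exec I g [] g
  | cons {g x ms g'} : x.Valid I g → Exec I (x.apply g) ms g' → Exec I g (x :: ms) g'

variable {I : Implementation n Var Val Intl Op Resp}

theorem Exec.append {g g' g'' : GlobalState n Var Val Intl Op Resp}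
    {ms ms' : List (Move n Var Val Intl Op Resp)} (h : Exec I g ms g') (h' : Exec I g' ms' g'') :
    Exec I g (ms ++ ms') g'' := by
  induction h with
  | nil => exact h'
  | cons hx _ ih => exact .cons hx (ih h')

theorem Exec.exists_of_append {g g'' : GlobalState n Var Val Intl Op Resp}
    {ms ms' : List (Move n Var Val Intl Op Resp)} (h : Exec I g (ms ++ ms') g'') :
    ∃ g', Exec I g ms g' ∧ Exec I g' ms' g'' := by
  induction ms generalizing g with
  | nil => exact ⟨g, .nil _, h⟩
  | cons x ms ih =>
    cases h with
    | cons hx h =>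
      obtain ⟨g', h1, h2⟩ := ih h
      exact ⟨g', .cons hx h1, h2⟩

theorem Exec.single {g : GlobalState n Var Val Intl Op Resp} {x : Move n Var Val Intl Op Resp}
    (h : x.Valid I g) : Exec I g [x] (x.apply g) := .cons h (.nil _)

theorem Exec.of_seq (st : ℕ → GlobalState n Var Val Intl Op Resp)
    (mv : ℕ → Move n Var Val Intl Op Resp) (hv : ∀ m, (mv m).Valid I (st m))
    (hs : ∀ m, st (m + 1) = (mv m).apply (st m)) (N : ℕ) :
    Exec I (st 0) ((List.range N).map mv) (st N) := by
  induction N with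
  | zero => exact .nil _
  | succ N ih =>
    rw [List.range_succ, List.map_append, hs]
    exact ih.append (.single (hv N))

/-- The states visited when the moves are chosen by `mv`. -/
noncomputable def iterMoves
    (mv : ℕ → GlobalState n Var Val Intl Op Resp → Move n Var Val Intl Op Resp)
    (g : GlobalState n Var Val Intl Op Resp) : ℕ → GlobalState n Var Val Intl Op Resp
  | 0 => g
  | m + 1 => (mv m (iterMoves mv g m)).apply (iterMoves mv g m)

/-- The definition splits off the last move; splitting off the first one matches the induction on
`Exec`. -/
theorem iterMoves_succ'
    (mv : ℕ → GlobalState n Var Val Intl Op Resp → Move n Var Val Intl Op Resp)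
    (g : GlobalState n Var Val Intl Op Resp) (m : ℕ) :
    iterMoves mv g (m + 1) = iterMoves (fun m => mv (m + 1)) ((mv 0 g).apply g) m := by
  induction m with
  | zero => rfl
  | succ m ih => rw [iterMoves, ih]; rfl

theorem Exec.iterMoves {g g' : GlobalState n Var Val Intl Op Resp}
    {ms : List (Move n Var Val Intl Op Resp)} (h : Exec I g ms g')
    (mv : ℕ → GlobalState n Var Val Intl Op Resp → Move n Var Val Intl Op Resp)
    (hmv : ∀ m x, ms[m]? = some x → ∀ g, mv m g = x) :
    iterMoves mv g ms.length = g' ∧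
      ∀ m < ms.length, (mv m (TSO.iterMoves mv g m)).Valid I (TSO.iterMoves mv g m) := by
  induction h generalizing mv with
  | nil => exact ⟨rfl, fun m hm => absurd hm (Nat.not_lt_zero m)⟩
  | @cons g x ms g' hx _ ih =>
    have h0 : mv 0 g = x := hmv 0 x rfl g
    obtain ⟨h1, h2⟩ := ih (fun m => mv (m + 1)) (fun m y hy => hmv (m + 1) y (by simpa using hy))
    refine ⟨by rw [List.length_cons, iterMoves_succ', h0, h1], fun m hm => ?_⟩
    cases m with
    | zero => simpa [TSO.iterMoves, h0] using hx
    | succ m =>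
      rw [iterMoves_succ', h0]
      exact h2 m (by simpa using hm)

/-- Follow `r` until time `T`, and then make the moves chosen by `mv`. -/
noncomputable def Run.extend (r : Run n Var Val Intl Op Resp) (T : ℕ)
    (mv : ℕ → GlobalState n Var Val Intl Op Resp → Move n Var Val Intl Op Resp) :
    Run n Var Val Intl Op Resp where
  state t := if t < T then r.state t else iterMoves mv (r.state T) (t - T)
  step t := if t < T then r.step t
    else (mv (t - T) (iterMoves mv (r.state T) (t - T))).toJoint

section Extend

variable (r : Run n Var Val Intl Op Resp) (T : ℕ)
  (mv : ℕ → GlobalState n Var Val Intl Op Resp → Move n Var Val Intl Op Resp)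

theorem Run.extend_state_of_le {t : ℕ} (ht : t ≤ T) : (r.extend T mv).state t = r.state t := by
  rcases ht.lt_or_eq with h | rfl
  · simp [Run.extend, h]
  · simp [Run.extend, iterMoves]

theorem Run.extend_step_of_lt {t : ℕ} (ht : t < T) : (r.extend T mv).step t = r.step t := by
  simp [Run.extend, ht]

theorem Run.extend_state_add (m : ℕ) :
    (r.extend T mv).state (T + m) = iterMoves mv (r.state T) m := by
  simp [Run.extend]

theorem Run.extend_step_add (m : ℕ) :
    (r.extend T mv).step (T + m) = (mv m (iterMoves mv (r.state T) m)).toJoint := by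
  simp [Run.extend]

variable {r}

theorem Run.IsRunOf.extend (hr : r.IsRunOf I)
    (hv : ∀ m, (mv m (iterMoves mv (r.state T) m)).Valid I (iterMoves mv (r.state T) m)) :
    (r.extend T mv).IsRunOf I := by
  refine ⟨?_, ?_, ?_, fun t => ?_, fun t => ?_, fun t i hi => ?_⟩
  · rw [r.extend_state_of_le T mv (Nat.zero_le _)]; exact hr.init_mem
  · rw [r.extend_state_of_le T mv (Nat.zero_le _)]; exact hr.init_buf
  · rw [r.extend_state_of_le T mv (Nat.zero_le _)]; exact hr.init_loc
  · rcases lt_or_ge t T with h | h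
    · rw [r.extend_step_of_lt T mv h, r.extend_state_of_le T mv h.le]; exact hr.enabled t
    · obtain ⟨m, rfl⟩ := Nat.exists_eq_add_of_le h
      rw [r.extend_step_add, r.extend_state_add]
      exact (hv m).enabled
  · rcases lt_or_ge t T with h | h
    · rw [r.extend_step_of_lt T mv h, r.extend_state_of_le T mv h.le,
        r.extend_state_of_le T mv h]
      exact hr.next t
    · obtain ⟨m, rfl⟩ := Nat.exists_eq_add_of_le h
      rw [r.extend_step_add, r.extend_state_add, Nat.add_assoc, r.extend_state_add,
        Move.next_toJoint]
      rfl
  · rcases lt_or_ge t T with h | h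
    · rw [r.extend_step_of_lt T mv h] at hi ⊢
      rw [r.extend_state_of_le T mv h.le]
      exact hr.protocol t i hi
    · obtain ⟨m, rfl⟩ := Nat.exists_eq_add_of_le h
      rw [r.extend_step_add] at hi ⊢
      rw [r.extend_state_add]
      exact (hv m).protocol i hi

end Extend

/-! ### Fair continuations of finite executions -/

open Classical in
/-- The move of the agent `a` in the state `g`; processes outside `S` do not move. -/
noncomputable def agentMove (I : Implementation n Var Val Intl Op Resp) (S : Set (Fin n))
    (g : GlobalState n Var Val Intl Op Resp) : Agent n → Move n Var Val Intl Op Resp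
  | .disp k => if g.tso.buf k ≠ [] then .prop k else .idle
  | .proc k =>
    if h : k ∈ S ∧ ∃ a ∈ I.protocol k (g.loc k), a ≠ .null ∧ g.tso.Enabled k a then
      .act k h.2.choose
    else .idle

theorem agentMove_valid (S : Set (Fin n)) (g : GlobalState n Var Val Intl Op Resp) (a : Agent n) :
    (agentMove I S g a).Valid I g := by
  cases a with
  | disp k =>
    simp only [agentMove]
    split_ifs with h
    · exact h
    · trivial
  | proc k =>
    simp only [agentMove]
    split_ifs with h
    · exact ⟨h.2.choose_spec.1, h.2.choose_spec.2.2⟩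
    · trivial

theorem agentMove_quiet (S : Set (Fin n)) (g : GlobalState n Var Val Intl Op Resp) (a : Agent n) :
    (agentMove I S g a).Quiet S := by
  cases a with
  | disp k => simp only [agentMove]; split_ifs <;> trivial
  | proc k =>
    simp only [agentMove]
    split_ifs with h
    · exact h.1
    · trivial

/-- The first component of the unpairing of `m` selects the agent; as the second one is free, each
agent is selected at arbitrarily late times. -/
theorem exists_agent_schedule [Nonempty (Fin n)] :
    ∃ f : ℕ → Agent n, ∀ a t, ∃ m, t ≤ m ∧ f m = a := by
  obtain ⟨e, he⟩ := exists_surjective_nat (Fin n ⊕ Fin n)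
  refine ⟨fun m => Sum.elim Agent.proc Agent.disp (e m.unpair.1), fun a t => ?_⟩
  have : ∃ b : Fin n ⊕ Fin n, Sum.elim Agent.proc Agent.disp b = a := by
    cases a with
    | proc i => exact ⟨.inl i, rfl⟩
    | disp i => exact ⟨.inr i, rfl⟩
  obtain ⟨b, hb⟩ := this
  obtain ⟨p, hp⟩ := he b
  exact ⟨Nat.pair p t, Nat.right_le_pair p t, by simp [hp, hb]⟩

theorem MemState.doAct_buf_ne_nil {s : MemState n Var Val} {i : Fin n} (h : s.buf i ≠ [])
    (k : Fin n) (a : Act Var Val Intl Resp) : (s.doAct k a).buf i ≠ [] := by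
  cases a <;> simp only [MemState.doAct] <;> try exact h
  by_cases hk : i = k
  · subst hk; simp
  · simpa [hk] using h

theorem MemState.doProp_buf_of_ne (s : MemState n Var Val) {i k : Fin n} (hk : i ≠ k) :
    (s.doProp k).buf i = s.buf i := by
  unfold MemState.doProp
  split
  · rfl
  · simp [hk]

/-- Only its own dispatcher can empty a buffer. Arbitrary joint actions are needed because fairness
also concerns items that are buffered in the given prefix of the run, where rounds need not be
single moves. -/
theorem MemState.doJoint_buf_ne_nil {s : MemState n Var Val} {i : Fin n} (h : s.buf i ≠ [])
    (a : JointAction n Var Val Intl Op Resp) (ha : a.prop i = false) :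
    (s.doJoint a).buf i ≠ [] := by
  have h1 : ∀ (l : List (Fin n)) (s : MemState n Var Val), s.buf i ≠ [] →
      (l.foldl (fun s i => s.doAct i (a.act i)) s).buf i ≠ [] := by
    intro l
    induction l with
    | nil => exact fun s hs => hs
    | cons k l ih => exact fun s hs => ih _ (doAct_buf_ne_nil hs k _)
  have h2 : ∀ (l : List (Fin n)) (s : MemState n Var Val), s.buf i ≠ [] →
      (l.foldl (fun s i => if a.prop i then s.doProp i else s) s).buf i ≠ [] := by
    intro l
    induction l with
    | nil => exact fun s hs => hs
    | cons k l ih =>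
      refine fun s hs => ih _ ?_
      dsimp only
      split_ifs with hk
      · rw [doProp_buf_of_ne]
        · exact hs
        · rintro rfl; simp [ha] at hk
      · exact hs
  exact h2 _ _ (h1 _ _ h)

/-- `r'` follows `r` until time `T`, makes the moves `ms`, which lead to `g`, and goes on with a
schedule that is fair to the dispatchers and to the processes in `S`, without the other processes
and without invocations. -/
structure Run.Continues (I : Implementation n Var Val Intl Op Resp)
    (r : Run n Var Val Intl Op Resp) (T : ℕ) (ms : List (Move n Var Val Intl Op Resp))
    (g : GlobalState n Var Val Intl Op Resp) (S : Set (Fin n))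
    (r' : Run n Var Val Intl Op Resp) : Prop where
  isRunOf : r'.IsRunOf I
  state_eq : ∀ t ≤ T, r'.state t = r.state t
  step_eq : ∀ t < T, r'.step t = r.step t
  moves : ∀ m x, ms[m]? = some x → r'.step (T + m) = x.toJoint
  state_moves : r'.state (T + ms.length) = g
  dispatchFair : r'.DispatchFair
  procFair : ∀ i ∈ S, r'.ProcFair I i
  tail : ∃ mv : ℕ → Move n Var Val Intl Op Resp, ∀ m,
    r'.step (T + ms.length + m) = (mv m).toJoint ∧
    (mv m).Valid I (r'.state (T + ms.length + m)) ∧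
    r'.state (T + ms.length + (m + 1)) = (mv m).apply (r'.state (T + ms.length + m)) ∧
    (mv m).Quiet S

/-- After the prescribed moves, agents take turns along a schedule that selects each of them
infinitely often, and the selected agent moves if it can. The set `S` serves two purposes: a
singleton gives the solo runs of obstruction-freedom, and `Set.univ` the fair runs of
linearizability. -/
theorem Run.IsRunOf.exists_continues [Nonempty (Fin n)] {r : Run n Var Val Intl Op Resp}
    (hr : r.IsRunOf I) (T : ℕ) {ms : List (Move n Var Val Intl Op Resp)}
    {g : GlobalState n Var Val Intl Op Resp} (h : Exec I (r.state T) ms g) (S : Set (Fin n)) :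
    ∃ r', Run.Continues I r T ms g S r' := by
  obtain ⟨f, hf⟩ := exists_agent_schedule (n := n)
  let mv : ℕ → GlobalState n Var Val Intl Op Resp → Move n Var Val Intl Op Resp :=
    fun m g => (ms[m]?).getD (agentMove I S g (f m))
  have hmv : ∀ m x, ms[m]? = some x → ∀ g, mv m g = x := fun m x hx g => by simp [mv, hx]
  have hmv' : ∀ m, ms.length ≤ m → ∀ g, mv m g = agentMove I S g (f m) := fun m hm g => by
    simp [mv, hm]
  obtain ⟨h1, h2⟩ := h.iterMoves mv hmv
  have hrun : (r.extend T mv).IsRunOf I := hr.extend T mv fun m => by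
    rcases lt_or_ge m ms.length with hm | hm
    · exact h2 m hm
    · rw [hmv' m hm]; exact agentMove_valid _ _ _
  have hstep : ∀ m, ms.length ≤ m → (r.extend T mv).step (T + m) =
      (agentMove I S ((r.extend T mv).state (T + m)) (f m)).toJoint := fun m hm => by
    rw [r.extend_step_add, hmv' m hm, r.extend_state_add]
  refine ⟨r.extend T mv, hrun, fun t => r.extend_state_of_le T mv,
    fun t => r.extend_step_of_lt T mv, fun m x hx => ?_, ?_, fun i t hb => ?_,
    fun i hi t => ?_,
    fun m => agentMove I S ((r.extend T mv).state (T + ms.length + m)) (f (ms.length + m)),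
    fun m => ⟨?_, agentMove_valid _ _ _, ?_, agentMove_quiet _ _ _⟩⟩
  · rw [r.extend_step_add, hmv m x hx]
  · rw [r.extend_state_add, h1]
  · by_contra! hno
    -- An item that is never propagated keeps the buffer nonempty forever, so the next turn of the
    -- dispatcher after the prescribed moves would propagate.
    have hbuf : ∀ m, ((r.extend T mv).state (t + m)).tso.buf i ≠ [] := fun m => by
      induction m with
      | zero => exact hb
      | succ m ih =>
        rw [← Nat.add_assoc, hrun.next]
        exact MemState.doJoint_buf_ne_nil ih _ (by simpa using hno (t + m) (Nat.le_add_right _ _))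
    obtain ⟨m, hm, hfm⟩ := hf (.disp i) (t + ms.length)
    obtain ⟨d, hd⟩ := Nat.exists_eq_add_of_le (show t ≤ T + m by omega)
    refine hno (T + m) (by omega) ?_
    have hne := hbuf d
    rw [← hd] at hne
    rw [hstep m (by omega), hfm]
    simp [agentMove, hne, Move.toJoint]
  · obtain ⟨m, hm, hfm⟩ := hf (.proc i) (t + ms.length)
    refine ⟨T + m, by omega, ?_⟩
    by_cases hc : (r.extend T mv).CanMove I i (T + m)
    · left
      rw [hstep m (by omega), hfm]
      simp only [agentMove]
      split_ifs with hc'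
      · simpa [Move.toJoint] using hc'.2.choose_spec.2.1
      · exact absurd ⟨hi, hc⟩ hc'
    · exact .inr hc
  · rw [Nat.add_assoc, hstep _ (by omega)]
    simp only [Nat.add_assoc]
  · rw [← Nat.add_assoc, hrun.next (T + ms.length + m)]
    simp only [Nat.add_assoc]
    rw [hstep _ (by omega), Move.next_toJoint]

namespace Run.Continues

variable {r r' : Run n Var Val Intl Op Resp} {T : ℕ}
  {ms : List (Move n Var Val Intl Op Resp)} {g : GlobalState n Var Val Intl Op Resp}
  {S : Set (Fin n)}

theorem mem_of_inv (h : Run.Continues I r T ms g S r') {m : ℕ} {p : Fin n} {o : Op}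
    (hm : (r'.step (T + m)).inv p = some o) : ms[m]? = some (.inv p o) := by
  rcases lt_or_ge m ms.length with hlt | hge
  · have hx : ms[m]? = some ms[m] := List.getElem?_eq_getElem hlt
    rw [h.moves m _ hx] at hm
    rw [hx, Move.eq_inv hm]
  · obtain ⟨mv, hmv⟩ := h.tail
    obtain ⟨d, rfl⟩ := Nat.exists_eq_add_of_le hge
    rw [← Nat.add_assoc, (hmv d).1] at hm
    have := (hmv d).2.2.2
    rw [Move.eq_inv hm] at this
    exact this.elim

/-- Reads an operation off the list of moves. The response is the step with index `T + a.length +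
b.length + 1`, and the end time is one more. -/
theorem opBetween (h : Run.Continues I r T ms g S r') {k : Fin n} {o : Op} {y : Resp}
    {a b c : List (Move n Var Val Intl Op Resp)}
    (hms : ms = a ++ .inv k o :: (b ++ .act k (.ret y) :: c))
    (hb : ∀ z, .act k (.ret z) ∉ b) :
    r'.OpBetween k o y (T + a.length) (T + a.length + b.length + 2) := by
  refine ⟨?_, T + a.length + b.length + 1, by omega, by omega, ?_, fun s hs hs' z hz => ?_⟩
  · rw [h.moves a.length (.inv k o) (by simp [hms])]
    simp [Move.toJoint]
  · have := h.moves (a.length + (b.length + 1)) (.act k (.ret y)) (by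
      rw [hms, List.getElem?_append_right (by omega)]; simp)
    rw [show T + a.length + b.length + 1 = T + (a.length + (b.length + 1)) by omega, this]
    simp [Move.toJoint]
  · obtain ⟨d, rfl⟩ := Nat.exists_eq_add_of_lt hs
    have hd : d < b.length := by omega
    have := h.moves (a.length + (d + 1)) b[d] (by
      rw [hms, List.getElem?_append_right (by omega)]
      simp [List.getElem?_append_left hd])
    rw [show T + a.length + d + 1 = T + (a.length + (d + 1)) by omega, this] at hz
    exact hb z (Move.eq_act hz (by simp) ▸ List.getElem_mem hd)

end Run.Continues

end Moves

/-! ### Repeating solo executions in other states -/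

section Replay

variable {n : ℕ} {Var Val Intl Op Resp : Type*}

open Classical in
theorem bufLookup_append_singleton (β : List (Var × Val)) (x y : Var) (v : Val) :
    bufLookup (β ++ [(x, v)]) y = if x = y then some v else bufLookup β y := by
  by_cases h : x = y <;> simp [bufLookup, List.filter_append, h]

open Classical in
theorem bufLookup_cons (β : List (Var × Val)) (x y : Var) (v : Val) :
    bufLookup ((x, v) :: β) y = (bufLookup β y).or (if x = y then some v else none) := by
  by_cases h : x = y
  · simp only [bufLookup, List.filter_cons, h, decide_true, if_true, List.getLast?_cons]
    cases (List.filter (fun p => decide (p.1 = y)) β).getLast? <;> rfl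
  · simp [bufLookup, h]

theorem MemState.readVal_congr {s s' : MemState n Var Val} {k : Fin n} (hb : s'.buf k = s.buf k)
    (hm : s'.mem = s.mem) (y : Var) : s'.readVal k y = s.readVal k y := by
  simp [MemState.readVal, hb, hm]

/-- The propagated item is the oldest one: either a newer entry for its variable still hides it, or
the value now found in memory is the one that was read from the buffer. -/
theorem MemState.readVal_doProp (s : MemState n Var Val) (k : Fin n) (y : Var) :
    (s.doProp k).readVal k y = s.readVal k y := by
  unfold MemState.doProp
  split
  · rfl
  · next x v β hb =>
    simp only [MemState.readVal, hb, bufLookup_cons, Function.update_self]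
    cases bufLookup β y
    · by_cases h : x = y
      · subst h; simp
      · simp [h, Ne.symm h]
    · simp

open Classical in
theorem MemState.readVal_doAct_write (s : MemState n Var Val) (k : Fin n) (x y : Var) (v : Val) :
    (s.doAct k (.write x v : Act Var Val Intl Resp)).readVal k y =
      if x = y then v else s.readVal k y := by
  simp only [MemState.doAct, MemState.readVal, Function.update_self, bufLookup_append_singleton]
  split_ifs <;> simp

theorem MemState.doAct_buf_of_ne (s : MemState n Var Val) {p k : Fin n} (hp : p ≠ k)
    (a : Act Var Val Intl Resp) : (s.doAct k a).buf p = s.buf p := by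
  cases a <;> simp [MemState.doAct, hp]

/-- The action is a fence or a read-modify-write. -/
def Act.IsSync (a : Act Var Val Intl Resp) : Prop :=
  a = .fence ∨ ∃ x vexp vnew, a = .rmw x vexp vnew

theorem MemState.doAct_mem {a : Act Var Val Intl Resp} (ha : ¬ a.IsSync)
    (s : MemState n Var Val) (k : Fin n) : (s.doAct k a).mem = s.mem := by
  cases a <;> simp_all [MemState.doAct, Act.IsSync]

theorem MemState.enabled_of_not_isSync {a : Act Var Val Intl Resp} (ha : ¬ a.IsSync)
    (s : MemState n Var Val) (k : Fin n) : s.Enabled k a := by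
  cases a <;> simp_all [MemState.Enabled, Act.IsSync]

theorem MemState.record_congr {s s' : MemState n Var Val} {k : Fin n}
    (h : ∀ y, s'.readVal k y = s.readVal k y) (a : Act Var Val Intl Resp) :
    (s'.record k a : List (Rec Var Val Intl Op Resp)) = s.record k a := by
  cases a <;> simp [MemState.record, h]

theorem MemState.readVal_doAct_congr {s s' : MemState n Var Val} {k : Fin n}
    (h : ∀ y, s'.readVal k y = s.readVal k y) {a : Act Var Val Intl Resp} (ha : ¬ a.IsSync)
    (y : Var) : (s'.doAct k a).readVal k y = (s.doAct k a).readVal k y := by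
  cases a with
  | write x v => simp [readVal_doAct_write, h]
  | rmw x e v => exact absurd (.inr ⟨x, e, v, rfl⟩) ha
  | _ => exact h y

variable {I : Implementation n Var Val Intl Op Resp}

/-- A solo execution of `j` without fences and read-modify-writes can be repeated without any
propagation: `j` takes the same steps, and memory does not change. -/
theorem Exec.exists_without_prop {j : Fin n} {g g' h : GlobalState n Var Val Intl Op Resp}
    {ms : List (Move n Var Val Intl Op Resp)} (he : Exec I g ms g')
    (hq : ∀ x ∈ ms, x.Quiet {j}) (hs : ∀ k a, .act k a ∈ ms → ¬ a.IsSync)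
    (hb : ∀ k ≠ j, g.tso.buf k = []) (hloc : h.loc = g.loc)
    (hview : ∀ y, h.tso.readVal j y = g.tso.readVal j y) :
    ∃ ms' h', Exec I h ms' h' ∧ (∀ x ∈ ms', x ∈ ms) ∧ h'.loc = g'.loc ∧
      h'.tso.mem = h.tso.mem ∧ ∀ k ≠ j, h'.tso.buf k = h.tso.buf k := by
  induction he generalizing h with
  | nil g => exact ⟨[], h, .nil _, by simp, hloc, rfl, fun _ _ => rfl⟩
  | @cons g x ms g' hx he ih =>
    have hq' : ∀ x ∈ ms, x.Quiet {j} := fun y hy => hq y (List.mem_cons_of_mem _ hy)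
    have hs' : ∀ k a, .act k a ∈ ms → ¬ a.IsSync := fun k a hy =>
      hs k a (List.mem_cons_of_mem _ hy)
    have hqx := hq x List.mem_cons_self
    cases x with
    | inv k o => exact hqx.elim
    | idle =>
      obtain ⟨ms', h', h1, h2, h3⟩ := ih hq' hs' hb hloc hview
      exact ⟨ms', h', h1, fun x hx => List.mem_cons_of_mem _ (h2 x hx), h3⟩
    | prop k =>
      -- The other buffers are empty, so only `j`'s own items can be propagated. This move is
      -- dropped: it changes nothing that `j` reads.
      obtain rfl : k = j := by by_contra hk; exact hx (hb k hk)
      obtain ⟨ms', h', h1, h2, h3⟩ := ih (h := h) hq' hs'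
        (fun p hp => (MemState.doProp_buf_of_ne _ hp).trans (hb p hp)) hloc
        (fun y => (hview y).trans (MemState.readVal_doProp _ _ _).symm)
      exact ⟨ms', h', h1, fun x hx => List.mem_cons_of_mem _ (h2 x hx), h3⟩
    | act k a =>
      obtain rfl : k = j := hqx
      have ha := hs k a List.mem_cons_self
      have hv : (Move.act k a).Valid I h :=
        ⟨by rw [hloc]; exact hx.1, MemState.enabled_of_not_isSync ha _ _⟩
      obtain ⟨ms', h', h1, h2, h3, h4, h5⟩ := ih (h := (Move.act k a).apply h) hq' hs'
        (fun p hp => (MemState.doAct_buf_of_ne _ hp a).trans (hb p hp))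
        (by simp only [Move.apply]; rw [hloc, MemState.record_congr hview])
        (fun y => MemState.readVal_doAct_congr hview ha y)
      refine ⟨.act k a :: ms', h', .cons hv h1, fun x hx => ?_, h3,
        h4.trans (MemState.doAct_mem ha _ _), fun p hp =>
        (h5 p hp).trans (MemState.doAct_buf_of_ne _ hp a)⟩
      rcases List.mem_cons.1 hx with rfl | hx
      · exact List.mem_cons_self
      · exact List.mem_cons_of_mem _ (h2 x hx)

/-- A solo execution of `k` can be repeated in any state in which the local state and the store
buffer of `k` and the memory are the same. -/
theorem Exec.exists_of_agree {k : Fin n} {g g' h : GlobalState n Var Val Intl Op Resp}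
    {ms : List (Move n Var Val Intl Op Resp)} (he : Exec I g ms g')
    (hq : ∀ x ∈ ms, x.Quiet {k} ∨ ∃ o, x = .inv k o)
    (hb : ∀ p ≠ k, g.tso.buf p = []) (hloc : h.loc k = g.loc k)
    (hbuf : h.tso.buf k = g.tso.buf k) (hmem : h.tso.mem = g.tso.mem) :
    ∃ h', Exec I h ms h' := by
  induction he generalizing h with
  | nil g => exact ⟨h, .nil _⟩
  | @cons g x ms g' hx he ih =>
    have hq' : ∀ x ∈ ms, x.Quiet {k} ∨ ∃ o, x = .inv k o :=
      fun y hy => hq y (List.mem_cons_of_mem _ hy)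
    have hqx := hq x List.mem_cons_self
    suffices hh : x.Valid I h ∧ (∀ p ≠ k, (x.apply g).tso.buf p = []) ∧
        (x.apply h).loc k = (x.apply g).loc k ∧
        (x.apply h).tso.buf k = (x.apply g).tso.buf k ∧
        (x.apply h).tso.mem = (x.apply g).tso.mem by
      obtain ⟨h', h1⟩ := ih hq' hh.2.1 hh.2.2.1 hh.2.2.2.1 hh.2.2.2.2
      exact ⟨h', .cons hh.1 h1⟩
    cases x with
    | idle => exact ⟨trivial, hb, hloc, hbuf, hmem⟩
    | inv p o =>
      obtain rfl : p = k := by simpa [Move.Quiet] using hqx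
      refine ⟨?_, hb, by simp [Move.apply, hloc], hbuf, hmem⟩
      simp only [Move.Valid, hloc]
      exact hx
    | prop p =>
      -- The other buffers are empty in `g` but need not be so in `h`; their contents are never
      -- propagated in the repetition, so they do not matter.
      obtain rfl : p = k := by by_contra hp; exact hx (hb p hp)
      refine ⟨by simp only [Move.Valid, hbuf]; exact hx,
        fun q hq => (MemState.doProp_buf_of_ne _ hq).trans (hb q hq), hloc, ?_, ?_⟩
      · simp only [Move.apply, MemState.doProp, hbuf]
        split
        · exact hbuf
        · simp
      · simp only [Move.apply, MemState.doProp, hbuf]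
        split
        · exact hmem
        · simp [hmem]
    | act p a =>
      obtain rfl : p = k := by simpa [Move.Quiet] using hqx
      refine ⟨⟨by rw [hloc]; exact hx.1, ?_⟩,
        fun q hq => (MemState.doAct_buf_of_ne _ hq a).trans (hb q hq), ?_, ?_, ?_⟩
      · have := hx.2
        cases a <;> simp_all [MemState.Enabled]
      · simp [Move.apply, hloc, MemState.record_congr (MemState.readVal_congr hbuf hmem)]
      · simp only [Move.apply]
        cases a <;> simp [MemState.doAct, hbuf]
      · simp only [Move.apply]
        cases a <;> simp [MemState.doAct, hmem]

theorem Exec.loc_of_ne {k p : Fin n} (hp : p ≠ k) {g g' : GlobalState n Var Val Intl Op Resp}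
    {ms : List (Move n Var Val Intl Op Resp)} (he : Exec I g ms g')
    (hq : ∀ x ∈ ms, x.Quiet {k}) : g'.loc p = g.loc p := by
  induction he with
  | nil => rfl
  | @cons g x ms g' hx he ih =>
    rw [ih fun y hy => hq y (List.mem_cons_of_mem _ hy)]
    have hqx := hq x List.mem_cons_self
    cases x with
    | inv q o => exact hqx.elim
    | act q a =>
      obtain rfl : q = k := hqx
      simp [Move.apply, hp]
    | _ => rfl

/-- All store buffers can be emptied by the dispatchers. -/
theorem Exec.exists_flush (I : Implementation n Var Val Intl Op Resp)
    (g : GlobalState n Var Val Intl Op Resp) :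
    ∃ ms g', Exec I g ms g' ∧ (∀ x ∈ ms, x.Quiet ∅) ∧ g'.loc = g.loc ∧
      ∀ k, g'.tso.buf k = [] := by
  -- Each propagation lowers the total number of buffered items by one.
  induction hN : ∑ k, (g.tso.buf k).length using Nat.strong_induction_on generalizing g with
  | _ N ih =>
    by_cases hb : ∀ k, g.tso.buf k = []
    · exact ⟨[], g, .nil _, by simp, rfl, hb⟩
    · push Not at hb
      obtain ⟨k, hk⟩ := hb
      have hlt : ∑ p, ((g.tso.doProp k).buf p).length < N := by
        rw [← hN]
        refine Finset.sum_lt_sum (fun p _ => ?_) ⟨k, Finset.mem_univ k, ?_⟩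
        · by_cases hp : p = k
          · subst hp
            unfold MemState.doProp
            split
            · rfl
            · next hb => simp [hb]
          · rw [MemState.doProp_buf_of_ne _ hp]
        · unfold MemState.doProp
          split
          · next hb => exact absurd hb hk
          · next hb => simp [hb]
      obtain ⟨ms, g', h1, h2, h3, h4⟩ := ih _ hlt ((Move.prop k).apply g) rfl
      refine ⟨.prop k :: ms, g', .cons hk h1, fun x hx => ?_, h3, h4⟩
      rcases List.mem_cons.1 hx with rfl | hx
      · trivial
      · exact h2 x hx

theorem LocalState.not_pending_append_ret (l : LocalState Var Val Intl Op Resp) (y : Resp) :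
    ¬ LocalState.Pending (l ++ [Rec.ret y] : LocalState Var Val Intl Op Resp) := by
  rintro ⟨l₁, o, l₂, h, hl⟩
  have h' := congrArg List.getLast? h
  rcases List.eq_nil_or_concat l₂ with rfl | ⟨l₃, z, rfl⟩
  · simp at h'
  · have h'' : Rec.ret y = z := by
      rw [List.concat_eq_append, ← List.cons_append, ← List.append_assoc, List.getLast?_concat,
        List.getLast?_concat] at h'
      exact Option.some_inj.1 h'
    exact hl y (by simp [h''])

theorem LocalState.pending_append_invoke (l : LocalState Var Val Intl Op Resp) (o : Op) :
    LocalState.Pending (l ++ [Rec.invoke o] : LocalState Var Val Intl Op Resp) :=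
  ⟨l, o, [], rfl, by simp⟩

end Replay

/-! ### Scans and updates in linearizations -/

section SnapshotObject

variable {n : ℕ} {W Var Val Intl : Type*}

/-- The contents of the snapshot object after the operations `L`. -/
def snapContents : (Fin n → Option W) → List (LinOp n W) → (Fin n → Option W)
  | V, [] => V
  | V, e :: L =>
    match e.op with
    | .update w => snapContents (Function.update V e.proc (some w)) L
    | .scan => snapContents V L

theorem SnapLegal.resp_scan {V : Fin n → Option W} {L₁ L₂ : List (LinOp n W)} {e : LinOp n W}
    (h : SnapLegal V (L₁ ++ e :: L₂)) (he : e.op = .scan) :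
    e.resp = .view (snapContents V L₁) := by
  induction L₁ generalizing V with
  | nil => simp only [List.nil_append, SnapLegal, he] at h; exact h.1
  | cons f L ih =>
    rw [List.cons_append, SnapLegal] at h
    rw [snapContents]
    cases hf : f.op <;> rw [hf] at h <;> exact ih h.2

theorem snapContents_append (V : Fin n → Option W) (L₁ L₂ : List (LinOp n W)) :
    snapContents V (L₁ ++ L₂) = snapContents (snapContents V L₁) L₂ := by
  induction L₁ generalizing V with
  | nil => rfl
  | cons f L ih =>
    rw [List.cons_append, snapContents, snapContents]
    split <;> exact ih _

theorem snapContents_of_forall_ne {V : Fin n → Option W} {L : List (LinOp n W)} {j : Fin n}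
    (h : ∀ e ∈ L, e.proc = j → ∀ w, e.op ≠ .update w) : snapContents V L j = V j := by
  induction L generalizing V with
  | nil => rfl
  | cons f L ih =>
    have ih' := fun V => ih (V := V) fun e he => h e (List.mem_cons_of_mem _ he)
    rw [snapContents]
    cases hw : f.op with
    | update w =>
      refine (ih' _).trans (Function.update_of_ne ?_ _ _)
      rintro rfl
      exact h f List.mem_cons_self rfl w hw
    | scan => exact ih' V

theorem exists_update_of_snapContents {V : Fin n → Option W} {L : List (LinOp n W)} {j : Fin n}
    {v : W} (h : snapContents V L j = some v) (hV : V j ≠ some v) :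
    ∃ e ∈ L, e.proc = j ∧ e.op = .update v := by
  induction L generalizing V with
  | nil => exact absurd h hV
  | cons f L ih =>
    rw [snapContents] at h
    cases hw : f.op with
    | update w =>
      rw [hw] at h
      by_cases hf : f.proc = j ∧ w = v
      · exact ⟨f, List.mem_cons_self, hf.1, hf.2 ▸ hw⟩
      · obtain ⟨e, he, h'⟩ := ih h (by
          by_cases hj : f.proc = j
          · subst hj; simpa using hf
          · rwa [Function.update_of_ne (Ne.symm hj)])
        exact ⟨e, List.mem_cons_of_mem _ he, h'⟩
    | scan =>
      rw [hw] at h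
      obtain ⟨e, he, h'⟩ := ih h hV
      exact ⟨e, List.mem_cons_of_mem _ he, h'⟩

variable {r : Run n Var Val Intl (SnapOp W) (SnapResp n W)} {T : ℕ} {L : List (LinOp n W)}

/-- A completed operation occurs in a linearization with its response. -/
theorem IsLinearization.exists_mem (hL : IsLinearization r T L) {i : Fin n} {o : SnapOp W}
    {y : SnapResp n W} {t t' : ℕ} (h : r.OpBetween i o y t t') (ht : t' ≤ T) :
    ∃ e ∈ L, e.proc = i ∧ e.start = t ∧ e.op = o ∧ e.resp = y := by
  obtain ⟨e, he, hp, hs⟩ := hL.completed i o y t t' h ht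
  have ho := (hL.invoked e he).2
  rw [hp, hs, h.1, Option.some_inj] at ho
  refine ⟨e, he, hp, hs, ho.symm, hL.response e he y t' ?_ ht⟩
  rw [hp, hs, ← ho]; exact h

/-- A scan does not show a value that has not been written. -/
theorem IsLinearization.scan_ne (hL : IsLinearization r T L) {k j : Fin n} {v : W}
    {y : SnapResp n W} {t t' : ℕ} (h : r.OpBetween k .scan y t t') (ht : t' ≤ T)
    (hno : ∀ s < T, (r.step s).inv j ≠ some (.update v)) :
    ∃ V, y = .view V ∧ V j ≠ some v := by
  obtain ⟨e, he, -, -, ho, rfl⟩ := hL.exists_mem h ht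
  obtain ⟨L₁, L₂, rfl⟩ := List.append_of_mem he
  refine ⟨_, hL.legal.resp_scan ho, fun hV => ?_⟩
  obtain ⟨f, hf, rfl, hfo⟩ := exists_update_of_snapContents hV (by simp)
  have := hL.invoked f (List.mem_append_left _ hf)
  exact hno _ this.1 (hfo ▸ this.2)

/-- A scan shows the last value whose writing was completed before. -/
theorem IsLinearization.scan_eq (hL : IsLinearization r T L) {k j : Fin n} {v : W}
    {y z : SnapResp n W} {t t' u u' : ℕ} (h : r.OpBetween k .scan y t t') (ht : t' ≤ T)
    (hu : r.OpBetween j (.update v) z u u') (hut : u' < t) (htt : t < t')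
    (hno : ∀ s < T, u < s → ∀ w, (r.step s).inv j ≠ some (.update w)) :
    ∃ V, y = .view V ∧ V j = some v := by
  obtain ⟨e, he, -, hes, ho, rfl⟩ := hL.exists_mem h ht
  obtain ⟨f, hf, hfp, hfs, hfo, -⟩ := hL.exists_mem hu (by omega)
  obtain ⟨L₁, L₂, rfl⟩ := List.append_of_mem he
  refine ⟨_, hL.legal.resp_scan ho, ?_⟩
  -- The update ended before the scan started, so real-time order puts it before the scan.
  have hf₁ : f ∈ L₁ := by
    rcases List.mem_append.1 hf with hf | hf
    · exact hf
    · rcases List.mem_cons.1 hf with rfl | hf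
      · rw [ho] at hfo; exact absurd hfo (by simp)
      · have := (List.pairwise_cons.1 (List.pairwise_append.1 hL.realTime).2.1).1 f hf
        refine absurd ⟨z, u', ?_, by omega, by omega⟩ this
        rw [hfp, hfo, hfs]; exact hu
  obtain ⟨L₃, L₄, rfl⟩ := List.append_of_mem hf₁
  have hpo := (List.pairwise_append.1 (List.pairwise_append.1 hL.procOrder).1).2.1
  rw [snapContents_append, snapContents, hfo]
  dsimp only
  rw [snapContents_of_forall_ne, hfp, Function.update_self]
  -- A later update of component `j` in the linearization would, by process order, have been invoked
  -- after time `u`.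
  intro e' he' hp w hw
  have h1 := hL.invoked e' (by simp [he'])
  have h2 := (List.pairwise_cons.1 hpo).1 e' he' (hfp.trans hp.symm)
  exact hno e'.start h1.1 (by omega) w (by rw [← hw, ← hp]; exact h1.2)

end SnapshotObject

/-! ### Consequences of obstruction-freedom -/

section Implementations

variable {n : ℕ} {W Var Val Intl : Type*}
  {I : Implementation n Var Val Intl (SnapOp W) (SnapResp n W)}
  {r r' : Run n Var Val Intl (SnapOp W) (SnapResp n W)} {T : ℕ}
  {ms : List (Move n Var Val Intl (SnapOp W) (SnapResp n W))}
  {g : GlobalState n Var Val Intl (SnapOp W) (SnapResp n W)} {S : Set (Fin n)}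

/-- The only update invoked after time `T`, if any, is `update v` at `j`, at position `N` of the
moves, and it is new by `hv`. -/
theorem Run.Continues.writeOnce (h : Run.Continues I r T ms g S r') (hrw : r.WriteOnce)
    {j : Fin n} {v : W} (hv : ∀ t < T, (r.step t).inv j ≠ some (.update v)) (N : ℕ)
    (hN : ∀ m p w, ms[m]? = some (.inv p (.update w)) → m = N ∧ p = j ∧ w = v) :
    r'.WriteOnce := by
  have key : ∀ p w t, T ≤ t → (r'.step t).inv p = some (.update w) →
      t = T + N ∧ p = j ∧ w = v := by
    intro p w t ht h1
    obtain ⟨m, rfl⟩ := Nat.exists_eq_add_of_le ht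
    obtain ⟨rfl, h2⟩ := hN m p w (h.mem_of_inv h1)
    exact ⟨rfl, h2⟩
  have key' : ∀ p w t t', t < T → T ≤ t' → (r'.step t).inv p = some (.update w) →
      (r'.step t').inv p = some (.update w) → False := by
    intro p w t t' ht ht' h1 h2
    obtain ⟨-, rfl, rfl⟩ := key p w t' ht' h2
    rw [h.step_eq t ht] at h1
    exact hv t ht h1
  intro p w t t' h1 h2
  rcases lt_or_ge t T with ht | ht <;> rcases lt_or_ge t' T with ht' | ht'
  · rw [h.step_eq t ht] at h1
    rw [h.step_eq t' ht'] at h2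
    exact hrw p w t t' h1 h2
  · exact (key' p w t t' ht ht' h1 h2).elim
  · exact (key' p w t' t ht' ht h2 h1).elim
  · rw [(key p w t ht h1).1, (key p w t' ht' h2).1]

/-- In an obstruction-free implementation, a pending operation can be completed by a solo
execution. -/
theorem ObstructionFree.exists_ret [Nonempty (Fin n)] (hOF : ObstructionFree I)
    (hr : r.IsRunOf I) (he : Exec I (r.state T) ms g) {k : Fin n}
    (hw : ∀ r', Run.Continues I r T ms g {k} r' → r'.WriteOnce) (hp : (g.loc k).Pending) :
    ∃ ms' y g', Exec I g (ms' ++ [.act k (.ret y)]) g' ∧ (∀ x ∈ ms', x.Quiet {k}) ∧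
      ∀ z, .act k (.ret z) ∉ ms' := by
  classical
  obtain ⟨r', hc⟩ := hr.exists_continues T he {k}
  obtain ⟨mv, hmv⟩ := hc.tail
  have hret : ∃ m y, (r'.step (T + ms.length + m)).act k = .ret y := by
    obtain ⟨s, y, hs, hy⟩ := hOF r' hc.isRunOf (hw r' hc) hc.dispatchFair k
      (hc.procFair k rfl) (T + ms.length) (by rw [hc.state_moves]; exact hp)
      (fun s hs p hpk => by
        obtain ⟨m, rfl⟩ := Nat.exists_eq_add_of_le hs
        by_contra hne
        have hq := (hmv m).2.2.2
        rw [Move.eq_act (congrFun (congrArg JointAction.act (hmv m).1.symm) p) hne] at hq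
        exact hpk hq)
    obtain ⟨m, rfl⟩ := Nat.exists_eq_add_of_le hs
    exact ⟨m, y, hy⟩
  -- The execution is cut at the first response, so that no earlier move is one.
  obtain ⟨y, hy⟩ := Nat.find_spec hret
  set M := Nat.find hret with hM
  have hlast : mv M = .act k (.ret y) := Move.eq_act ((hmv M).1 ▸ hy) (by simp)
  have hex := Exec.of_seq (fun m => r'.state (T + ms.length + m)) mv (fun m => (hmv m).2.1)
    (fun m => (hmv m).2.2.1) (M + 1)
  rw [List.range_succ, List.map_append, List.map_singleton, hlast, Nat.add_zero,
    hc.state_moves] at hex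
  refine ⟨_, y, _, hex, fun x hx => ?_, fun z hz => ?_⟩
  · obtain ⟨m, -, rfl⟩ := List.mem_map.1 hx
    exact (hmv m).2.2.2
  · obtain ⟨m, hm, hmz⟩ := List.mem_map.1 hz
    refine Nat.find_min hret (List.mem_range.1 hm) ⟨z, ?_⟩
    rw [(hmv m).1, hmz]
    simp [Move.toJoint]

/-- The move is not an invocation of an update. -/
def Move.NoUpdate (x : Move n Var Val Intl (SnapOp W) (SnapResp n W)) : Prop :=
  ∀ p w, x ≠ .inv p (.update w)

theorem Move.Quiet.noUpdate {x : Move n Var Val Intl (SnapOp W) (SnapResp n W)}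
    (h : x.Quiet S) : x.NoUpdate := by
  rintro p w rfl; exact h

/-- Process `k` can complete its pending operation, if any. -/
theorem ObstructionFree.exists_not_pending [Nonempty (Fin n)] (hOF : ObstructionFree I)
    (hr : r.IsRunOf I) (hrw : r.WriteOnce) {j : Fin n} {v : W}
    (hv : ∀ t < T, (r.step t).inv j ≠ some (.update v))
    (he : Exec I (r.state T) ms g) (hms : ∀ x ∈ ms, x.NoUpdate) (k : Fin n) :
    ∃ ms' g', Exec I g ms' g' ∧ (∀ x ∈ ms', x.Quiet {k}) ∧ ¬ (g'.loc k).Pending := by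
  by_cases hp : (g.loc k).Pending
  -- No update is invoked in `ms`, so the position `0` given to `writeOnce` is a dummy.
  · obtain ⟨ms', y, g', h1, h2, -⟩ := hOF.exists_ret hr he (fun r' hc =>
      hc.writeOnce hrw hv 0 fun m p w hm => absurd rfl (hms _ (List.mem_of_getElem? hm) p w)) hp
    refine ⟨_, g', h1, fun x hx => ?_, ?_⟩
    · rcases List.mem_append.1 hx with hx | hx
      · exact h2 x hx
      · rw [List.mem_singleton.1 hx]; exact rfl
    · obtain ⟨g₁, -, h⟩ := h1.exists_of_append
      cases h with
      | cons hx h =>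
        cases h
        simpa [Move.apply, MemState.record] using
          LocalState.not_pending_append_ret (g₁.loc k) y
  · exact ⟨[], g, .nil _, by simp, hp⟩

end Implementations

/-! ### An update needs a fence or a read-modify-write -/

section Main

variable {n : ℕ} {W Var Val Intl : Type*}
  {I : Implementation n Var Val Intl (SnapOp W) (SnapResp n W)}
  {r r' : Run n Var Val Intl (SnapOp W) (SnapResp n W)} {T : ℕ}

theorem Run.OpBetween.of_step_eq {i : Fin n} {o : SnapOp W} {y : SnapResp n W} {t t' : ℕ}
    (h : r.OpBetween i o y t t') (heq : ∀ s < t', r'.step s = r.step s) :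
    r'.OpBetween i o y t t' := by
  obtain ⟨h1, u, h2, rfl, h4, h5⟩ := h
  refine ⟨by rw [heq t (by omega)]; exact h1, u, h2, rfl, by rw [heq u (by omega)]; exact h4,
    fun s hs hs' => ?_⟩
  rw [heq s (by omega)]; exact h5 s hs hs'

theorem inv_update_unique {a b : List (Move n Var Val Intl (SnapOp W) (SnapResp n W))} {j : Fin n}
    {v : W} (ha : ∀ x ∈ a, x.NoUpdate) (hb : ∀ x ∈ b, x.NoUpdate) (m : ℕ) (p : Fin n) (w : W)
    (h : (a ++ .inv j (.update v) :: b)[m]? = some (.inv p (.update w))) :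
    m = a.length ∧ p = j ∧ w = v := by
  rcases lt_trichotomy m a.length with hm | rfl | hm
  · rw [List.getElem?_append_left hm] at h
    exact absurd rfl (ha _ (List.mem_of_getElem? h) p w)
  · simp at h
    exact ⟨rfl, h.1.symm, h.2.symm⟩
  · obtain ⟨d, rfl⟩ := Nat.exists_eq_add_of_lt hm
    rw [List.getElem?_append_right (by omega), show a.length + d + 1 - a.length = d + 1 by omega,
      List.getElem?_cons_succ] at h
    exact absurd rfl (hb _ (List.mem_of_getElem? h) p w)

/-- From every reachable state, a state can be reached in which the store buffers are empty and
`j` and `k` have no pending operations. -/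
theorem ObstructionFree.exists_quiescent [Nonempty (Fin n)] (hOF : ObstructionFree I)
    (hr : r.IsRunOf I) (hrw : r.WriteOnce) {j : Fin n} {v : W}
    (hv : ∀ t < T, (r.step t).inv j ≠ some (.update v)) {k : Fin n} (hkj : k ≠ j) :
    ∃ ms g, Exec I (r.state T) ms g ∧ ms ≠ [] ∧ (∀ x ∈ ms, x.NoUpdate) ∧
      ¬ (g.loc j).Pending ∧ ¬ (g.loc k).Pending ∧ ∀ p, g.tso.buf p = [] := by
  -- The idle move makes the list nonempty, so that the update will start strictly after time `T`.
  have h0 : Exec I (r.state T) [.idle] (r.state T) := .single trivial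
  obtain ⟨m₁, g₁, h1, q1, p1⟩ := hOF.exists_not_pending hr hrw hv h0
    (fun x hx => by rw [List.mem_singleton.1 hx]; intro p w; simp) j
  have n1 : ∀ x ∈ [.idle] ++ m₁, x.NoUpdate := fun x hx => by
    rcases List.mem_append.1 hx with hx | hx
    · rw [List.mem_singleton.1 hx]; intro p w; simp
    · exact (q1 x hx).noUpdate
  obtain ⟨m₂, g₂, h2, q2, p2⟩ := hOF.exists_not_pending hr hrw hv (h0.append h1) n1 k
  obtain ⟨m₃, g₃, h3, q3, e3, b3⟩ := Exec.exists_flush I g₂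
  refine ⟨([.idle] ++ m₁) ++ m₂ ++ m₃, g₃, ((h0.append h1).append h2).append h3, by simp,
    fun x hx => ?_, ?_, ?_, b3⟩
  · rcases List.mem_append.1 hx with hx | hx
    · rcases List.mem_append.1 hx with hx | hx
      · exact n1 x hx
      · exact (q2 x hx).noUpdate
    · exact (q3 x hx).noUpdate
  -- The solo execution of `k` and the flushing leave the local state of `j` alone, so `j` still has
  -- nothing pending.
  · rw [e3, h2.loc_of_ne hkj.symm q2]; exact p1
  · rw [e3]; exact p2

/-- From a state with empty store buffers in which neither `j` nor `k` has a pending operation, a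
solo execution of a new update by `j` contains a fence or a read-modify-write. -/
theorem exists_isSync_of_update [Nonempty (Fin n)] (hOF : ObstructionFree I)
    (hLin : Linearizable I) (hr : r.IsRunOf I) (hrw : r.WriteOnce) {j k : Fin n} {v : W}
    (hv : ∀ t < T, (r.step t).inv j ≠ some (.update v)) (hkj : k ≠ j)
    {ms ms' : List (Move n Var Val Intl (SnapOp W) (SnapResp n W))} {z : SnapResp n W}
    {g g' : GlobalState n Var Val Intl (SnapOp W) (SnapResp n W)}
    (he : Exec I (r.state T) ms g) (hms : ∀ x ∈ ms, x.NoUpdate)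
    (hpk : ¬ (g.loc k).Pending) (hbuf : ∀ p, g.tso.buf p = [])
    (hinv : (Move.inv j (.update v)).Valid I g)
    (hup : Exec I ((Move.inv j (.update v)).apply g) (ms' ++ [.act j (.ret z)]) g')
    (hq : ∀ x ∈ ms', x.Quiet {j}) (hnoret : ∀ y, .act j (.ret y) ∉ ms') :
    ∃ p a, .act p a ∈ ms' ∧ a.IsSync := by
  by_contra! hs
  have hinvk : (Move.inv k SnapOp.scan).Valid I g := hpk
  have noUpd_inv : (Move.inv k .scan : Move n Var Val Intl (SnapOp W) (SnapResp n W)).NoUpdate := by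
    intro p w; simp
  have noUpd_act : ∀ p a,
      (Move.act p a : Move n Var Val Intl (SnapOp W) (SnapResp n W)).NoUpdate := by
    intro p a q w; simp
  -- a solo scan by `k` without the update
  have heA := he.append (Exec.single hinvk)
  have nA : ∀ x ∈ ms ++ [.inv k .scan], x.NoUpdate := fun x hx => by
    rcases List.mem_append.1 hx with hx | hx
    · exact hms x hx
    · rw [List.mem_singleton.1 hx]; exact noUpd_inv
  obtain ⟨mA, y, gA, eA, qA, rA⟩ := hOF.exists_ret (k := k) hr heA
    (fun r' hc => hc.writeOnce hrw hv 0
      fun m p w hm => absurd rfl (nA _ (List.mem_of_getElem? hm) p w))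
    (by simpa [Move.apply] using LocalState.pending_append_invoke (g.loc k) SnapOp.scan)
  have nmA : ∀ x ∈ mA ++ [.act k (.ret y)], x.NoUpdate := fun x hx => by
    rcases List.mem_append.1 hx with hx | hx
    · exact (qA x hx).noUpdate
    · rw [List.mem_singleton.1 hx]; exact noUpd_act _ _
  have nA' : ∀ x ∈ ms ++ .inv k .scan :: (mA ++ [.act k (.ret y)]), x.NoUpdate := fun x hx => by
    rcases List.mem_append.1 hx with hx | hx
    · exact hms x hx
    · rcases List.mem_cons.1 hx with rfl | hx
      · exact noUpd_inv
      · exact nmA x hx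
  -- Linearizability is only available for fair runs, so now all processes are scheduled; the
  -- linearized prefix stops at the end of the scan.
  obtain ⟨rA', cA⟩ := hr.exists_continues T (he.append (.cons hinvk eA)) Set.univ
  have opA := cA.opBetween rfl rA
  obtain ⟨LA, hLA⟩ := hLin rA' cA.isRunOf
    (cA.writeOnce hrw hv 0 fun m p w hm => absurd rfl (nA' _ (List.mem_of_getElem? hm) p w))
    ⟨cA.dispatchFair, fun p => cA.procFair p trivial⟩ (T + ms.length + mA.length + 2)
  obtain ⟨V, rfl, hV⟩ := hLA.scan_ne (j := j) (v := v) opA le_rfl fun s _ hs' => by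
    rcases lt_or_ge s T with h | h
    · rw [cA.step_eq s h] at hs'; exact hv s h hs'
    · obtain ⟨m, rfl⟩ := Nat.exists_eq_add_of_le h
      exact nA' _ (List.mem_of_getElem? (cA.mem_of_inv hs')) j v rfl
  -- the same scan after the update, whose writes have not been propagated
  obtain ⟨g₁, hup₁, hret⟩ := hup.exists_of_append
  obtain ⟨mB, h, eB, sB, lB, memB, bB⟩ := hup₁.exists_without_prop
    (h := (Move.inv j (.update v)).apply g) hq hs
    (fun p _ => hbuf p) rfl (fun _ => rfl)
  have hretv : (Move.act j (.ret z)).Valid I h := by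
    cases hret with
    | cons hx _ => exact ⟨by rw [lB]; exact hx.1, trivial⟩
  -- Here `j` has responded, but all its writes are still buffered: memory and the local state and
  -- buffer of `k` are as in `g`, so `k` can repeat its scan with the same response.
  set h' := (Move.act j (.ret z)).apply h with hh'
  have hlk : h'.loc k = g.loc k := by
    have h1 : h'.loc k = h.loc k := by simp [hh', Move.apply, hkj]
    rw [h1, lB, hup₁.loc_of_ne hkj hq]
    simp [Move.apply, hkj]
  obtain ⟨hC, eC⟩ := (Exec.cons hinvk eA).exists_of_agree (k := k) (h := h')
    (fun x hx => by
      rcases List.mem_cons.1 hx with rfl | hx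
      · exact .inr ⟨_, rfl⟩
      · rcases List.mem_append.1 hx with hx | hx
        · exact .inl (qA x hx)
        · rw [List.mem_singleton.1 hx]; exact .inl rfl)
    (fun p _ => hbuf p) hlk (bB k hkj) memB
  -- Real-time order requires the update to end strictly before the scan starts; without the idle
  -- round the two times would coincide.
  have eCC := he.append (.cons hinv (eB.append (.cons hretv (.cons (x := .idle) trivial eC))))
  obtain ⟨rC, cC⟩ := hr.exists_continues T eCC Set.univ
  have nB : ∀ x ∈ mB ++ .act j (.ret z) :: .idle ::
      .inv k .scan :: (mA ++ [.act k (.ret (.view V))]), x.NoUpdate := fun x hx => by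
    rcases List.mem_append.1 hx with hx | hx
    · exact (hq x (sB x hx)).noUpdate
    · simp only [List.mem_cons (a := x)] at hx
      rcases hx with rfl | rfl | rfl | hx
      · exact noUpd_act _ _
      · intro p w; simp
      · exact noUpd_inv
      · exact nmA x hx
  have uniq := inv_update_unique (j := j) (v := v) hms nB
  have opU := cC.opBetween rfl fun y hy => hnoret y (sB _ hy)
  have opC := cC.opBetween (k := k) (o := .scan) (y := .view V)
    (a := ms ++ .inv j (.update v) :: (mB ++ [.act j (.ret z), .idle])) (b := mA) (c := [])
    (by simp) rA
  obtain ⟨LC, hLC⟩ := hLin rC cC.isRunOf (cC.writeOnce hrw hv _ uniq)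
    ⟨cC.dispatchFair, fun p => cC.procFair p trivial⟩ _
  obtain ⟨V', hVV, hV'⟩ := hLC.scan_eq opC le_rfl opU
    (by simp only [List.length_append, List.length_cons, List.length_nil]; omega)
    (by omega)
    (fun s _ hus w hsw => by
      obtain ⟨m, rfl⟩ := Nat.exists_eq_add_of_le (show T ≤ s by omega)
      have := (uniq m j w (cC.mem_of_inv hsw)).1
      omega)
  rw [SnapResp.view.injEq] at hVV
  exact hV (hVV ▸ hV')

end Main

end TSO

theorem mainTheorem9 {n : ℕ} (hn : 2 ≤ n) {W Var Val Intl : Type*} [Finite Var]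
    (I : TSO.Implementation n Var Val Intl (TSO.SnapOp W) (TSO.SnapResp n W))
    (hOF : TSO.ObstructionFree I) (hLin : TSO.Linearizable I)
    (r : TSO.Run n Var Val Intl (TSO.SnapOp W) (TSO.SnapResp n W))
    (hr : r.IsRunOf I) (hrw : r.WriteOnce)
    (i : Fin n) (y : TSO.SnapResp n W) (ts te : ℕ)
    (hscan : r.OpBetween i TSO.SnapOp.scan y ts te)
    (hsolo : r.Solo i ts te) (hsync : ¬ r.ContainsSync i ts te)
    (j : Fin n) (v : W)
    (hv : ∀ t, t < te → (r.step t).inv j ≠ some (TSO.SnapOp.update v)) :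
    ∃ r' : TSO.Run n Var Val Intl (TSO.SnapOp W) (TSO.SnapResp n W),
      r'.IsRunOf I ∧ r'.WriteOnce ∧ r'.Fair I ∧
      (∀ t, t ≤ te → (r'.state t).loc i = (r.state t).loc i) ∧
      r'.OpBetween i TSO.SnapOp.scan y ts te ∧
      ∃ (z : TSO.SnapResp n W) (us ue : ℕ),
        te < us ∧ r'.OpBetween j (TSO.SnapOp.update v) z us ue ∧ r'.ContainsSync j us ue := by
  have : Nonempty (Fin n) := ⟨j⟩
  have : Nontrivial (Fin n) := Fin.nontrivial_iff_two_le.2 hn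
  -- The observer `k` may be any process other than `j`, whether or not it is the scanner `i`.
  obtain ⟨k, hkj⟩ := exists_ne j
  obtain ⟨ms, g, he, hne, hms, hpj, hpk, hbuf⟩ := hOF.exists_quiescent hr hrw hv hkj
  have hinv : (TSO.Move.inv j (TSO.SnapOp.update v)).Valid I g := hpj
  obtain ⟨mu, z, g', hup, hq, hnoret⟩ := hOF.exists_ret (k := j) hr
    (he.append (TSO.Exec.single hinv))
    (fun r' hc => hc.writeOnce hrw hv _
      (TSO.inv_update_unique hms (b := []) (by simp)))
    (by simpa [TSO.Move.apply] using
      TSO.LocalState.pending_append_invoke (g.loc j) (TSO.SnapOp.update v))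
  obtain ⟨p, a, hpa, ha⟩ :=
    TSO.exists_isSync_of_update hOF hLin hr hrw hv hkj he hms hpk hbuf hinv hup hq hnoret
  -- In the solo execution, only `j` performs actions.
  obtain rfl : p = j := hq _ hpa
  obtain ⟨r', hc⟩ := hr.exists_continues te (he.append (.cons hinv hup)) Set.univ
  have hmu : ∀ x ∈ mu ++ [.act p (.ret z)], x.NoUpdate := fun x hx => by
    rcases List.mem_append.1 hx with hx | hx
    · exact (hq x hx).noUpdate
    · rw [List.mem_singleton.1 hx]; intro q w; simp
  refine ⟨r', hc.isRunOf, hc.writeOnce hrw hv _ (TSO.inv_update_unique hms hmu),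
    ⟨hc.dispatchFair, fun q => hc.procFair q trivial⟩,
    fun t ht => by rw [hc.state_eq t ht], hscan.of_step_eq hc.step_eq,
    z, te + ms.length, te + ms.length + mu.length + 2, ?_, hc.opBetween rfl hnoret, ?_⟩
  · have := List.length_pos_iff.2 hne
    omega
  · obtain ⟨m, hm, hma⟩ := List.getElem_of_mem hpa
    -- The invocation occupies position `ms.length`, so the moves of the update are shifted by one
    -- more.
    refine ⟨te + (ms.length + (m + 1)), by omega, by omega, ?_⟩
    rw [hc.moves (ms.length + (m + 1)) (.act p a) (by
      rw [List.getElem?_append_right (by omega)]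
      simp [List.getElem?_append_left hm, ← hma])]
    simpa [TSO.Move.toJoint, TSO.Act.IsSync] using ha
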